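/- Let $k$ be a field, and let $n\ge 0$, $c\ge 1$ and $\bar d=(d_1,\dots,d_c)$ with all $d_l\ge 1$ be integers; put $d=\max_l d_l$. For $e\ge 1$ let $\mathbb V_{n,e}=(\mathbb A^e)^n$ and let $$P_{n,e}:\mathbb V_{n,e}\to\mathbb A,\qquad P_{n,e}(w_1,\dots,w_n)=\sum_{i=1}^n\prod_{j=1}^e x_i^j,\qquad w_i=(x_i^1,\dots,x_i^e),$$ and let $\mathbb X_{n,e}=\{P_{n,e}=0\}\subset\mathbb V_{n,e}$. On $\mathbb V=\prod_{l=1}^c\mathbb V_{n,d_l}$, with projections $p_l$ to the factors, consider the collection $\bar P_{n,\bar d}=\{P_{n,d_l}\circ p_l\}_{1\le l\le c}$, which defines $\mathbb X_{n,\bar d}=\prod_{l=1}^c\mathbb X_{n,d_l}\subset\mathbb V$. The $k$-rank $r(P)\in\{0,1,2,\dots\}\cup\{\infty\}$ of a polynomial $P$ over $k$ is the least $r$ such that $P=\sum_{i=1}^r Q_iR_i$ with polynomials $Q_i,R_i$ over $k$ of degree strictly smaller than $\deg P$ (and $\infty$ if there is no such $r$). The rank $r(\bar P)$ of a finite collection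 $\bar P$ is the minimum, over all degrees $e$ that occur in $\bar P$, of the ranks of the non-trivial $k$-linear combinations of the members of $\bar P$ of degree $e$. For a field $K$ and a subset $X$ of a finite-dimensional $K$-vector space $V$, a function $f:X\to K$ is weakly polynomial of degree $\le a$ if its restriction to every affine subspace of $V$ contained in $X$ is a polynomial of degree $\le a$. A subvariety $\mathbb X\subset\mathbb V$ over $k$ has property $\star_a$ if for every finite extension $K/k$ every weakly polynomial function of degree $\le a$ on $\mathbb X(K)$ is the restriction of a polynomial function of degree $\le a$ on $\mathbb V(K)$. For $a\ge 1$ the field $k$ is called admissible (for $a,d$) if $|k|>ad$, $k$ contains a root of unity of order $m>2a$, and $\operatorname{char}(k)$ is $0$ or $>d$. Then: 1. $r(\bar P_{n,\bar d})\ge n/d$. 2. For every $a\ge 1$ such that $k$ is admissible for $a,d$, the variety $\mathbb X_{n,\bar d}\subset\mathbb V$ has property $\star_a$. -/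

import Mathlib

open scoped ENNReal

universe u

noncomputable section

namespace WeakPoly

/-- A field `k` is admissible for `(a, d)`: it has more than `a * d` elements, it contains a root of
unity of (exact) order `m > 2 * a`, and its characteristic is `0` or larger than `d`. -/
structure Admissible (k : Type u) [Field k] (a d : ℕ) : Prop where
  card_gt : ((a * d : ℕ) : ℕ∞) < ENat.card k
  exists_root : ∃ (m : ℕ) (β : k), 2 * a < m ∧ IsPrimitiveRoot β m
  char_gt : ringChar k = 0 ∨ d < ringChar k

/-- On the subset `S` of the coordinate space `K^σ`, the function `f` is given by a polynomial of
degree at most `a` on `K^σ`. If `S` is an affine subspace, this is the usual notion of a polynomial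
function of degree at most `a` on `S`, since such functions extend along an affine projection
onto `S`. -/
def IsPolyOn {K σ : Type*} [Field K] (a : ℕ) (S : Set (σ → K)) (f : (σ → K) → K) : Prop :=
  ∃ F : MvPolynomial σ K, F.totalDegree ≤ a ∧ ∀ x ∈ S, f x = MvPolynomial.eval x F

/-- `f` is weakly polynomial of degree at most `a` on `S`: its restriction to every affine subspace
contained in `S` is a polynomial of degree at most `a`. Only the values of `f` on `S` matter. -/
def IsWeaklyPolyOn {K σ : Type*} [Field K] (a : ℕ) (S : Set (σ → K)) (f : (σ → K) → K) : Prop :=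
  ∀ L : AffineSubspace K (σ → K), (L : Set (σ → K)) ⊆ S → IsPolyOn a (L : Set (σ → K)) f

/-- The property of a set `S ⊆ K^σ`: every weakly polynomial function of degree at most `a` on `S`
is the restriction of a polynomial of degree at most `a` on `K^σ`. -/
def StarOver {K σ : Type*} [Field K] (a : ℕ) (S : Set (σ → K)) : Prop :=
  ∀ f : (σ → K) → K, IsWeaklyPolyOn a S f → IsPolyOn a S f

/-- The set of `K`-points of the subscheme of affine space over `k` defined by a collection `P`. -/
def points {k σ ι : Type*} [Field k] (P : ι → MvPolynomial σ k) (K : Type*) [Field K]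
    [Algebra k K] : Set (σ → K) :=
  {x | ∀ s, MvPolynomial.aeval x (P s) = 0}

/-- The subscheme defined by the collection `P` has the property `⋆_a`: for every finite extension
`K / k`, its set of `K`-points satisfies `StarOver a`. -/
def HasStar {k : Type u} {σ ι : Type*} [Field k] (a : ℕ) (P : ι → MvPolynomial σ k) : Prop :=
  ∀ (K : Type u) [Field K] [Algebra k K] [FiniteDimensional k K], StarOver a (points P K)

/-- The `k`-rank of a polynomial `P`: the minimal `r` such that `P` is a sum of `r` products of two
polynomials of degree strictly smaller than that of `P`; it is `⊤` if there is no such `r`. -/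
def rank {k σ : Type*} [Field k] (P : MvPolynomial σ k) : ℕ∞ :=
  ⨅ (r : ℕ) (_ : ∃ Q R : Fin r → MvPolynomial σ k,
    (∀ i, (Q i).totalDegree < P.totalDegree ∧ (R i).totalDegree < P.totalDegree) ∧
      P = ∑ i, Q i * R i), (r : ℕ∞)

/-- The rank of a collection: the minimum, over all degrees `e`, of the ranks of the non-trivial
`k`-linear combinations of the members of degree `e`. -/
def collectionRank {k σ ι : Type*} [Field k] [Fintype ι] (P : ι → MvPolynomial σ k) : ℕ∞ :=
  ⨅ (e : ℕ) (b : ι → k) (_ : b ≠ 0) (_ : ∀ s, b s ≠ 0 → (P s).totalDegree = e),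
    rank (∑ s, b s • P s)

/-- The polynomial `P_{n,d}(w_1, …, w_n) = ∑ i, μ (w_i)` on `V_{n,d} = (𝔸^d)^n`, where
`μ (x^1, …, x^d) = ∏ j, x^j`. -/
def basicPoly (k : Type*) [Field k] (n d : ℕ) : MvPolynomial (Fin n × Fin d) k :=
  ∑ i : Fin n, ∏ j : Fin d, MvPolynomial.X (i, j)

/-- The collection `P_{n,d_l} ∘ p_l`, for `l` in `Fin c`, on the product of the spaces `V_{n,d_l}`,
where `p_l` is the projection to the `l`-th factor. -/
def productCollection (k : Type*) [Field k] (n : ℕ) {c : ℕ} (dbar : Fin c → ℕ) (l : Fin c) :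
    MvPolynomial (Σ l : Fin c, Fin n × Fin (dbar l)) k :=
  MvPolynomial.rename (fun ij => (⟨l, ij⟩ : Σ l : Fin c, Fin n × Fin (dbar l)))
    (basicPoly k n (dbar l))

end WeakPoly

end

/-! Rank: if a form of degree `e` is a sum of `r` products of polynomials of smaller degree, it lies
in `I * I`, where `I` is generated by the components of degrees `1, …, e - 1` of the factors. Its
gradient then lies in `I`, hence by Krull in a prime of height at most `2r(e - 1)`
(`exists_prime_pderiv_mem`). The derivatives of `∑ i, ∏ j, x i j` are block products with one factor
removed, so a prime containing them contains two variables of each of the `n` blocks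
(`exists_finset_X_mem`) and has height at least `2n`.

Extension: scaling one chosen variable per block multiplies all block products by the same scalar,
so it moves a point of the variety along a line inside the variety. These scalings commute, and
interpolation in the scaling parameter splits a weakly polynomial function into weakly polynomial
pieces homogeneous for every choice at once (`isPolyOn_of_forall_isHomogeneousFor`). For a nonzero
piece `f`, take a choice of least degree. Comparing scalings gives `f x = (∏ v, x v ^ e v) * f x'`,
where `x'` has the block products of `x` and unchosen coordinates `1` (`eq_prod_mul_normalize`).
Such `x'` form an affine subspace of the variety, so `f x'` is a polynomial in the block products.

Hence `f` is a polynomial of degree at most `a * d`. The variety is a cone on whose lines `f` has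
degree at most `a`, and `|K| > a * d`, so truncation to degree `a` does not change the values
(`exists_totalDegree_le_eval_eq`). -/

noncomputable section

namespace WeakPoly

open MvPolynomial

/-! ### Heights of primes containing the gradient of a form -/

section Rank

variable {k σ : Type*} [Field k]

/-- The algebra map which sends the variables in `V` to zero and fixes the others. -/
def killVars (V : Finset σ) [DecidableEq σ] : MvPolynomial σ k →ₐ[k] MvPolynomial σ k :=
  aeval fun v => if v ∈ V then 0 else X v

/-- Modulo `p` the variables in `V` are already zero, so the quotient map factors through `killVars
V`. -/
theorem ker_killVars_le [DecidableEq σ] (V : Finset σ) (p : Ideal (MvPolynomial σ k))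
    (h : ∀ v ∈ V, (X v : MvPolynomial σ k) ∈ p) :
    RingHom.ker (killVars (k := k) V) ≤ p := by
  have hcomp : (Ideal.Quotient.mkₐ k p).comp (killVars V) = Ideal.Quotient.mkₐ k p := by
    ext v
    by_cases hv : v ∈ V
    · simpa [killVars, hv] using (Ideal.Quotient.eq_zero_iff_mem.2 (h v hv)).symm
    · simp [killVars, hv]
  intro f hf
  have := DFunLike.congr_fun hcomp f
  rw [AlgHom.comp_apply, (RingHom.mem_ker).1 hf, map_zero] at this
  exact Ideal.Quotient.eq_zero_iff_mem.1 this.symm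

/-- The kernels are prime because the target is a domain, and each new variable enlarges the kernel
strictly, which gives a chain of primes of length `V.card`. -/
theorem card_le_height_ker_killVars [DecidableEq σ] (V : Finset σ) :
    (V.card : ℕ∞) ≤ (RingHom.ker (killVars (k := k) V)).height := by
  induction V using Finset.induction_on with
  | empty => simp
  | insert u V hu ih =>
    have : (RingHom.ker (killVars (k := k) V)).IsPrime := RingHom.ker_isPrime _
    have : (RingHom.ker (killVars (k := k) (insert u V))).IsPrime := RingHom.ker_isPrime _
    have hlt : RingHom.ker (killVars (k := k) V) < RingHom.ker (killVars (k := k) (insert u V)) := by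
      refine lt_of_le_of_ne (ker_killVars_le V _ fun v hv => ?_) fun heq => ?_
      · simp [RingHom.mem_ker, killVars, hv]
      · have h1 : (X u : MvPolynomial σ k) ∈ RingHom.ker (killVars (k := k) (insert u V)) := by
          simp [RingHom.mem_ker, killVars]
        rw [← heq] at h1
        simp [RingHom.mem_ker, killVars, hu] at h1
    rw [Finset.card_insert_of_notMem hu, Nat.cast_add, Nat.cast_one]
    exact (add_le_add_left ih 1).trans (Ideal.height_add_one_le_of_lt_of_isPrime hlt)

theorem card_le_height [DecidableEq σ] (V : Finset σ) (p : Ideal (MvPolynomial σ k))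
    (h : ∀ v ∈ V, (X v : MvPolynomial σ k) ∈ p) : (V.card : ℕ∞) ≤ p.height :=
  (card_le_height_ker_killVars V).trans (Ideal.height_mono (ker_killVars_le V p h))

theorem pderiv_mem_of_mem_mul {I : Ideal (MvPolynomial σ k)} {f : MvPolynomial σ k}
    (hf : f ∈ I * I) (v : σ) : pderiv v f ∈ I := by
  refine Submodule.mul_induction_on hf (fun g hg h hh => ?_) fun g h hg hh => ?_
  · rw [Derivation.leibniz]
    exact I.add_mem (I.mul_mem_right _ hg) (I.mul_mem_right _ hh)
  · rw [map_add]
    exact I.add_mem hg hh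

/-- Both factors have degree below `e`, so if components of degrees `i + j = e` multiply, neither
`i` nor `j` is zero: constant terms never contribute. -/
theorem homogeneousComponent_mul_mem {I : Ideal (MvPolynomial σ k)} {e : ℕ}
    {Q R : MvPolynomial σ k} (hQ : Q.totalDegree < e) (hR : R.totalDegree < e)
    (hIQ : ∀ j, 1 ≤ j → j < e → homogeneousComponent j Q ∈ I)
    (hIR : ∀ j, 1 ≤ j → j < e → homogeneousComponent j R ∈ I) :
    homogeneousComponent e (Q * R) ∈ I * I := by
  have : homogeneousComponent e (Q * R) =
      ∑ i ∈ Finset.range (Q.totalDegree + 1), ∑ j ∈ Finset.range (R.totalDegree + 1),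
        if e = i + j then homogeneousComponent i Q * homogeneousComponent j R else 0 := by
    conv_lhs => rw [← sum_homogeneousComponent Q, ← sum_homogeneousComponent R,
      Finset.sum_mul_sum, map_sum]
    refine Finset.sum_congr rfl fun i _ => ?_
    rw [map_sum]
    refine Finset.sum_congr rfl fun j _ => ?_
    exact homogeneousComponent_of_mem
      ((homogeneousComponent_isHomogeneous i Q).mul (homogeneousComponent_isHomogeneous j R))
  rw [this]
  refine Ideal.sum_mem _ fun i hi => Ideal.sum_mem _ fun j hj => ?_
  rw [Finset.mem_range] at hi hj
  split_ifs with h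
  · exact Ideal.mul_mem_mul (hIQ i (by omega) (by omega)) (hIR j (by omega) (by omega))
  · exact Ideal.zero_mem _

/-- If a form of degree `e` is a sum of `r` products of polynomials of degree less than `e`, then
its partial derivatives lie in a common prime ideal of height at most `2 * r * (e - 1)`. -/
theorem exists_prime_pderiv_mem [Finite σ] {e r : ℕ} {P : MvPolynomial σ k} (hP : P.IsHomogeneous e)
    (Q R : Fin r → MvPolynomial σ k) (hQ : ∀ i, (Q i).totalDegree < e)
    (hR : ∀ i, (R i).totalDegree < e) (h : P = ∑ i, Q i * R i) :
    ∃ p : Ideal (MvPolynomial σ k), p.IsPrime ∧ (∀ v, pderiv v P ∈ p) ∧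
      p.height ≤ (2 * (r * (e - 1)) : ℕ) := by
  classical
  -- The shift by one makes the degrees run over `1, …, e - 1`, hence at most `2 * (r * (e - 1))`
  -- generators.
  let g : Bool × Fin r × Fin (e - 1) → MvPolynomial σ k := fun t =>
    homogeneousComponent (t.2.2 + 1) (if t.1 then Q t.2.1 else R t.2.1)
  let s : Finset (MvPolynomial σ k) := Finset.univ.image g
  let I : Ideal (MvPolynomial σ k) := Ideal.span s
  have hmem : ∀ t, g t ∈ I := fun t => Ideal.subset_span (by simp [s])
  have hPI : P ∈ I * I := by
    rw [← homogeneousComponent_eq_self hP, h, map_sum]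
    refine Ideal.sum_mem _ fun i _ => homogeneousComponent_mul_mem (hQ i) (hR i) ?_ ?_
    · intro j hj hje
      have := hmem (true, i, ⟨j - 1, by omega⟩)
      simpa [g, Nat.sub_add_cancel hj] using this
    · intro j hj hje
      have := hmem (false, i, ⟨j - 1, by omega⟩)
      simpa [g, Nat.sub_add_cancel hj] using this
  -- The generators have no constant term, so `I` lies in the ideal of the origin and has a minimal
  -- prime.
  have hI : I ≠ ⊤ := by
    intro htop
    have hle : I ≤ RingHom.ker (constantCoeff : MvPolynomial σ k →+* k) := by
      refine Ideal.span_le.2 fun x hx => ?_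
      obtain ⟨t, -, rfl⟩ := Finset.mem_image.1 (Finset.mem_coe.1 hx)
      simp [RingHom.mem_ker, g, constantCoeff_eq, coeff_homogeneousComponent]
    rw [htop, top_le_iff] at hle
    exact RingHom.ker_ne_top _ hle
  obtain ⟨p, hp⟩ := Ideal.nonempty_minimalPrimes hI
  refine ⟨p, hp.1.1, fun v => hp.1.2 (pderiv_mem_of_mem_mul hPI v),
    (Ideal.height_le_card_of_mem_minimalPrimes_span_finset hp).trans ?_⟩
  have : s.card ≤ 2 * (r * (e - 1)) := Finset.card_image_le.trans (by simp)
  exact_mod_cast this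

end Rank

/-! ### The rank of the product collection -/

section Collection

variable {k : Type u} [Field k] {n c : ℕ} {dbar : Fin c → ℕ}

theorem productCollection_eq (l : Fin c) : productCollection k n dbar l =
    ∑ i : Fin n, ∏ j : Fin (dbar l), X ⟨l, (i, j)⟩ := by
  simp [productCollection, basicPoly]

theorem isHomogeneous_productCollection (l : Fin c) :
    (productCollection k n dbar l).IsHomogeneous (dbar l) := by
  rw [productCollection_eq]
  refine IsHomogeneous.sum _ _ _ fun i _ => ?_
  simpa using IsHomogeneous.prod Finset.univ
    (fun j : Fin (dbar l) => (X ⟨l, (i, j)⟩ : MvPolynomial (Σ l : Fin c, Fin n × Fin (dbar l)) k))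
    (fun _ => 1) fun j _ => isHomogeneous_X _ _

theorem productCollection_ne_zero (hn : 0 < n) (hdbar : ∀ l, 1 ≤ dbar l) (l : Fin c) :
    productCollection k n dbar l ≠ 0 := by
  intro h
  have := congrArg (eval fun v => if v.2.1 = (⟨0, hn⟩ : Fin n) then (1 : k) else 0) h
  rw [productCollection_eq, map_sum, map_zero,
    Finset.sum_eq_single_of_mem (⟨0, hn⟩ : Fin n) (Finset.mem_univ _)] at this
  · simp [map_prod] at this
  · intro i _ hi
    have hl := hdbar l
    simp only [map_prod, eval_X, hi, if_false, Finset.prod_const, Finset.card_univ, Fintype.card_fin]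
    exact zero_pow (by omega)

theorem pderiv_prod_eq_zero {σ ι : Type*} (v : σ) (s : Finset ι) (g : ι → MvPolynomial σ k)
    (h : ∀ i ∈ s, pderiv v (g i) = 0) : pderiv v (∏ i ∈ s, g i) = 0 := by
  refine Finset.prod_induction g (fun x => pderiv v x = 0) (fun x y hx hy => ?_) ?_ h
  · rw [Derivation.leibniz, hx, hy, smul_zero, smul_zero, add_zero]
  · exact Derivation.map_one_eq_zero _

theorem pderiv_productCollection (l l' : Fin c) (i : Fin n) (m : Fin (dbar l)) :
    pderiv ⟨l, (i, m)⟩ (productCollection k n dbar l') =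
      if l' = l then ∏ j ∈ Finset.univ.erase m, X ⟨l, (i, j)⟩ else 0 := by
  have hne : ∀ {v w : Σ l : Fin c, Fin n × Fin (dbar l)}, w ≠ v →
      pderiv v (X w : MvPolynomial (Σ l : Fin c, Fin n × Fin (dbar l)) k) = 0 := fun h =>
    pderiv_X_of_ne h
  rw [productCollection_eq, map_sum]
  split_ifs with h
  · subst h
    rw [Finset.sum_eq_single_of_mem i (Finset.mem_univ _),
      ← Finset.mul_prod_erase _ _ (Finset.mem_univ m), Derivation.leibniz, pderiv_X_self,
      pderiv_prod_eq_zero _ _ _ fun j hj => hne ?_]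
    · simp
    · intro h
      exact (Finset.mem_erase.1 hj).1 (by simpa using h)
    · intro i' _ hi'
      refine pderiv_prod_eq_zero _ _ _ fun j _ => hne fun h => hi' ?_
      have := congrArg (fun v : Σ l : Fin c, Fin n × Fin (dbar l) => v.2.1) h
      exact this
  · refine Finset.sum_eq_zero fun i' _ => pderiv_prod_eq_zero _ _ _ fun j _ => hne fun h' => h ?_
    exact congrArg Sigma.fst h'

/-- A prime containing the partial derivatives of `∑ i, ∏ j, x i j` contains two of the variables
of each block. -/
theorem exists_finset_X_mem {p : Ideal (MvPolynomial (Σ l : Fin c, Fin n × Fin (dbar l)) k)}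
    (hp : p.IsPrime) {l : Fin c} (hl : 1 ≤ dbar l)
    (h : ∀ (i : Fin n) (m : Fin (dbar l)),
      (∏ j ∈ Finset.univ.erase m, X ⟨l, (i, j)⟩ : MvPolynomial _ k) ∈ p) :
    ∃ V : Finset (Σ l : Fin c, Fin n × Fin (dbar l)), V.card = 2 * n ∧
      ∀ v ∈ V, (X v : MvPolynomial _ k) ∈ p := by
  have key : ∀ (i : Fin n) (m : Fin (dbar l)), ∃ j, j ≠ m ∧
      (X ⟨l, (i, j)⟩ : MvPolynomial (Σ l : Fin c, Fin n × Fin (dbar l)) k) ∈ p := by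
    intro i m
    obtain ⟨j, hj, hjp⟩ := (hp.prod_mem_iff).1 (h i m)
    exact ⟨j, (Finset.mem_erase.1 hj).1, hjp⟩
  choose g hg hgp using key
  let m₀ : Fin (dbar l) := ⟨0, hl⟩
  -- Omitting `m₀` yields one variable of the block in `p`; omitting that variable yields a second,
  -- different one.
  let φ : Fin n × Bool → Σ l : Fin c, Fin n × Fin (dbar l) := fun t =>
    ⟨l, (t.1, if t.2 then g t.1 m₀ else g t.1 (g t.1 m₀))⟩
  have hφ : Function.Injective φ := by
    rintro ⟨i, b⟩ ⟨i', b'⟩ h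
    simp only [φ, Sigma.mk.injEq, heq_eq_eq, true_and, Prod.mk.injEq] at h
    obtain ⟨rfl, h⟩ := h
    have h1 := hg i (g i m₀)
    rcases b with _ | _ <;> rcases b' with _ | _
    · rfl
    · exact absurd h h1
    · exact absurd h.symm h1
    · rfl
  refine ⟨Finset.univ.map ⟨φ, hφ⟩, by simp [mul_comm], ?_⟩
  simp only [Finset.mem_map, Finset.mem_univ, true_and, Function.Embedding.coeFn_mk]
  rintro _ ⟨⟨i, b⟩, rfl⟩
  cases b <;> simp [φ, hgp]

/-- Derivatives along the variables of a factor `l` with `b l ≠ 0` see only `b l • P_l`, and `b l`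
is a unit. The two height bounds give `2n ≤ 2r(e - 1)`. -/
theorem le_mul_of_combination_eq_sum (hdbar : ∀ l, 1 ≤ dbar l) {d : ℕ} (hd : ∀ l, dbar l ≤ d)
    {e : ℕ} {b : Fin c → k} (hb : b ≠ 0)
    (he : ∀ s, b s ≠ 0 → (productCollection k n dbar s).totalDegree = e) {r : ℕ}
    (Q R : Fin r → MvPolynomial (Σ l : Fin c, Fin n × Fin (dbar l)) k)
    (hQR : ∀ i, (Q i).totalDegree < (∑ s, b s • productCollection k n dbar s).totalDegree ∧
      (R i).totalDegree < (∑ s, b s • productCollection k n dbar s).totalDegree)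
    (h : ∑ s, b s • productCollection k n dbar s = ∑ i, Q i * R i) : n ≤ d * r := by
  classical
  rcases Nat.eq_zero_or_pos n with rfl | hn
  · exact Nat.zero_le _
  have hdeg : ∀ s, b s ≠ 0 → dbar s = e := fun s hs => by
    rw [← he s hs, (isHomogeneous_productCollection s).totalDegree
      (productCollection_ne_zero hn hdbar s)]
  obtain ⟨l, hl⟩ := Function.ne_iff.1 hb
  have hhom : (∑ s, b s • productCollection k n dbar s).IsHomogeneous e := by
    refine IsHomogeneous.sum _ _ _ fun s _ => ?_
    rw [smul_eq_C_mul]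
    by_cases hs : b s = 0
    · simpa [hs] using isHomogeneous_zero _ _ _
    · have := isHomogeneous_productCollection (k := k) (n := n) (dbar := dbar) s
      rw [hdeg s hs] at this
      exact this.C_mul _
  obtain ⟨p, hp, hder, hht⟩ := exists_prime_pderiv_mem hhom Q R
    (fun i => (hQR i).1.trans_le hhom.totalDegree_le)
    (fun i => (hQR i).2.trans_le hhom.totalDegree_le) h
  obtain ⟨V, hV, hVp⟩ := exists_finset_X_mem hp (hdbar l) fun i m => by
    have := hder ⟨l, (i, m)⟩
    simp only [map_sum, Derivation.map_smul, pderiv_productCollection, smul_ite, smul_zero,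
      Finset.sum_ite_eq', Finset.mem_univ, if_true] at this
    rw [smul_eq_C_mul] at this
    refine (hp.mem_or_mem this).resolve_left fun hC => hp.ne_top ?_
    exact Ideal.eq_top_of_isUnit_mem _ hC ((isUnit_iff_ne_zero.2 hl).map C)
  have h1 := (card_le_height V p hVp).trans hht
  rw [hV] at h1
  have h2 : 2 * n ≤ 2 * (r * (e - 1)) := by exact_mod_cast h1
  have h3 : e ≤ d := hdeg l hl ▸ hd l
  calc n ≤ r * (e - 1) := by omega
    _ ≤ r * d := Nat.mul_le_mul_left _ (by omega)
    _ = d * r := mul_comm _ _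

theorem div_le_collectionRank (hdbar : ∀ l, 1 ≤ dbar l) {d : ℕ} (hd1 : 1 ≤ d)
    (hd : ∀ l, dbar l ≤ d) :
    (n : ℝ≥0∞) / (d : ℝ≥0∞) ≤ ((collectionRank (productCollection k n dbar) : ℕ∞) : ℝ≥0∞) := by
  -- Ranks are integral or infinite, so the bound can first be proved for the rounded-up quotient.
  have key : ((n ⌈/⌉ d : ℕ) : ℕ∞) ≤ collectionRank (productCollection k n dbar) := by
    refine le_iInf fun e => le_iInf fun b => le_iInf fun hb => le_iInf fun he => ?_
    refine le_iInf fun r => le_iInf fun hr => ?_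
    obtain ⟨Q, R, hQR, h⟩ := hr
    have := le_mul_of_combination_eq_sum hdbar hd hb he Q R hQR h
    exact_mod_cast (ceilDiv_le_iff_le_mul hd1).2 (by simpa using this)
  refine le_trans ?_ (ENat.toENNReal_mono key)
  refine ENNReal.div_le_of_le_mul' ?_
  have : n ≤ d * (n ⌈/⌉ d) := by
    simpa using le_smul_ceilDiv (b := n) (Nat.lt_of_lt_of_le Nat.zero_lt_one hd1)
  rw [ENat.toENNReal_coe]
  exact_mod_cast this

end Collection

/-! ### Polynomials of degree below the size of the field -/

section LargeField

variable {K σ τ : Type*} [Field K]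

theorem exists_finset_card_eq_succ {K : Type*} {D : ℕ} (hD : (D : ℕ∞) < ENat.card K) :
    ∃ T : Finset K, T.card = D + 1 := by
  rcases finite_or_infinite K with h | h
  · have := Fintype.ofFinite K
    rw [ENat.card_eq_coe_fintype_card] at hD
    obtain ⟨T, -, hT⟩ := Finset.exists_subset_card_eq (s := (Finset.univ : Finset K))
      (n := D + 1) (by rw [Finset.card_univ]; exact_mod_cast hD)
    exact ⟨T, hT⟩
  · exact Infinite.exists_subset_card_eq K (D + 1)

theorem polynomial_eq_of_eval_eq {D : ℕ} (hD : (D : ℕ∞) < ENat.card K) {p q : Polynomial K}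
    (hp : p.natDegree ≤ D) (hq : q.natDegree ≤ D) (h : ∀ s, p.eval s = q.eval s) : p = q := by
  obtain ⟨T, hT⟩ := exists_finset_card_eq_succ hD
  refine Polynomial.eq_of_degrees_lt_of_eval_finset_eq T ?_ ?_ fun s _ => h s
  · rw [hT]
    exact (Polynomial.degree_le_of_natDegree_le hp).trans_lt (by exact_mod_cast Nat.lt_succ_self D)
  · rw [hT]
    exact (Polynomial.degree_le_of_natDegree_le hq).trans_lt (by exact_mod_cast Nat.lt_succ_self D)

theorem totalDegree_aeval_le {D : ℕ} (g : σ → MvPolynomial τ K)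
    (hg : ∀ v, (g v).totalDegree ≤ D) (F : MvPolynomial σ K) :
    (aeval g F).totalDegree ≤ D * F.totalDegree := by
  rw [aeval_def, eval₂_eq]
  refine totalDegree_finsetSum_le fun m hm => ?_
  refine (totalDegree_mul _ _).trans ?_
  rw [algebraMap_eq, totalDegree_C, zero_add]
  refine (totalDegree_finsetProd _ _).trans ?_
  calc ∑ v ∈ m.support, (g v ^ m v).totalDegree ≤ ∑ v ∈ m.support, D * m v :=
        Finset.sum_le_sum fun v _ => (totalDegree_pow _ _).trans (by
          rw [mul_comm]; exact Nat.mul_le_mul_right _ (hg v))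
    _ = D * m.sum fun _ e => e := by rw [← Finset.mul_sum]; rfl
    _ ≤ D * F.totalDegree := Nat.mul_le_mul_left _ (le_totalDegree hm)

theorem eval_aeval_eq (x : τ → K) (g : σ → MvPolynomial τ K) (F : MvPolynomial σ K) :
    eval x (aeval g F) = eval (fun v => eval x (g v)) F := by
  induction F using MvPolynomial.induction_on with
  | C r => simp
  | add F G hF hG => rw [map_add, map_add, map_add, hF, hG]
  | mul_X F v hF => rw [map_mul, map_mul, map_mul, hF, aeval_X, eval_X]

/-- The restriction of a polynomial to a line. -/
theorem exists_polynomial_eval_line (F : MvPolynomial σ K) (x y : σ → K) :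
    ∃ p : Polynomial K, p.natDegree ≤ F.totalDegree ∧ ∀ s : K, eval (x + s • y) F = p.eval s := by
  refine ⟨aeval (fun v => Polynomial.C (x v) + Polynomial.C (y v) * Polynomial.X) F, ?_,
    fun s => ?_⟩
  · rw [aeval_def, eval₂_eq]
    refine Polynomial.natDegree_sum_le_of_forall_le _ _ fun m hm => ?_
    refine Polynomial.natDegree_mul_le.trans ?_
    rw [Polynomial.algebraMap_eq, Polynomial.natDegree_C, zero_add]
    refine (Polynomial.natDegree_prod_le _ _).trans ?_
    refine le_trans (Finset.sum_le_sum fun v _ => ?_) (le_totalDegree hm)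
    refine Polynomial.natDegree_pow_le.trans ?_
    have : (Polynomial.C (x v) + Polynomial.C (y v) * Polynomial.X).natDegree ≤ 1 := by
      compute_degree
    exact (Nat.mul_le_mul_left _ this).trans (mul_one _).le
  · induction F using MvPolynomial.induction_on with
    | C r => simp
    | add F G hF hG => simp [hF, hG]
    | mul_X F v hF =>
      simp only [map_mul, eval_X, aeval_X, hF, Polynomial.eval_mul, Polynomial.eval_add,
        Polynomial.eval_C, Polynomial.eval_X, Pi.add_apply, Pi.smul_apply, smul_eq_mul]
      ring

theorem eval_smul_of_isHomogeneous {F : MvPolynomial σ K} {i : ℕ} (hF : F.IsHomogeneous i)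
    (s : K) (x : σ → K) : eval (s • x) F = s ^ i * eval x F := by
  rw [eval_eq, eval_eq, Finset.mul_sum]
  refine Finset.sum_congr rfl fun m hm => ?_
  have : ∑ v ∈ m.support, m v = i := (hF.degree_eq_sum_deg_support hm).symm
  rw [← this, ← Finset.prod_pow_eq_pow_sum]
  simp only [Pi.smul_apply, smul_eq_mul, mul_pow, Finset.prod_mul_distrib]
  ring

/-- On the line through the origin and `x`, the component of degree `i` contributes the coefficient
of `s ^ i`; more than `D` scalars determine the coefficients. -/
theorem eval_homogeneousComponent_eq_coeff {D : ℕ} (hD : (D : ℕ∞) < ENat.card K)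
    {F : MvPolynomial σ K} (hF : F.totalDegree ≤ D) {p : Polynomial K} (hp : p.natDegree ≤ D)
    {x : σ → K} (h : ∀ s : K, eval (s • x) F = p.eval s) (i : ℕ) :
    eval x (homogeneousComponent i F) = p.coeff i := by
  have hq : p = ∑ i ∈ Finset.range (F.totalDegree + 1),
      Polynomial.C (eval x (homogeneousComponent i F)) * Polynomial.X ^ i := by
    refine polynomial_eq_of_eval_eq hD hp ?_ fun s => ?_
    · refine Polynomial.natDegree_sum_le_of_forall_le _ _ fun i hi => ?_
      refine (Polynomial.natDegree_C_mul_X_pow_le _ _).trans ?_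
      rw [Finset.mem_range] at hi
      omega
    · rw [← h]
      conv_lhs => rw [← sum_homogeneousComponent F, map_sum]
      rw [Polynomial.eval_finsetSum]
      refine Finset.sum_congr rfl fun i _ => ?_
      rw [eval_smul_of_isHomogeneous (homogeneousComponent_isHomogeneous i F)]
      rw [Polynomial.eval_mul, Polynomial.eval_C, Polynomial.eval_pow, Polynomial.eval_X, mul_comm]
  rw [hq, Polynomial.finsetSum_coeff]
  simp only [Polynomial.coeff_C_mul_X_pow, Finset.sum_ite_eq, Finset.mem_range]
  split_ifs with hi
  · rfl
  · rw [homogeneousComponent_eq_zero _ _ (by omega), map_zero]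

/-- On a union of lines through the origin on each of which it has degree at most `a`, a polynomial
of degree less than the size of the field agrees with its truncation to degree `a`. -/
theorem exists_totalDegree_le_eval_eq {D a : ℕ} (hD : (D : ℕ∞) < ENat.card K) (ha : a ≤ D)
    {F : MvPolynomial σ K} (hF : F.totalDegree ≤ D) {S : Set (σ → K)}
    (hS : ∀ x ∈ S, ∃ p : Polynomial K, p.natDegree ≤ a ∧ ∀ s : K, eval (s • x) F = p.eval s) :
    ∃ G : MvPolynomial σ K, G.totalDegree ≤ a ∧ ∀ x ∈ S, eval x F = eval x G := by
  refine ⟨∑ i ∈ Finset.range (a + 1), homogeneousComponent i F, ?_, fun x hx => ?_⟩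
  · refine totalDegree_finsetSum_le fun i hi => ?_
    rw [Finset.mem_range] at hi
    exact (homogeneousComponent_isHomogeneous i F).totalDegree_le.trans (by omega)
  · obtain ⟨p, hp, h⟩ := hS x hx
    have h1 := h 1
    rw [one_smul, Polynomial.eval_eq_sum_range' (Nat.lt_succ_of_le hp)] at h1
    rw [h1, map_sum]
    refine Finset.sum_congr rfl fun i _ => ?_
    rw [eval_homogeneousComponent_eq_coeff hD hF (hp.trans ha) h]
    simp

end LargeField

/-! ### Operations on weakly polynomial functions -/

section WeaklyPoly

variable {K σ : Type*} [Field K] {a : ℕ} {S : Set (σ → K)} {f : (σ → K) → K}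

theorem IsWeaklyPolyOn.exists_polynomial_line (hf : IsWeaklyPolyOn a S f) {x y : σ → K}
    (h : ∀ s : K, x + s • y ∈ S) :
    ∃ p : Polynomial K, p.natDegree ≤ a ∧ ∀ s : K, f (x + s • y) = p.eval s := by
  let L : AffineSubspace K (σ → K) := AffineSubspace.mk' x (Submodule.span K {y})
  have hmem : ∀ s : K, x + s • y ∈ L := fun s => by
    rw [AffineSubspace.mem_mk', vsub_eq_sub, add_sub_cancel_left]
    exact Submodule.smul_mem _ _ (Submodule.mem_span_singleton_self y)
  obtain ⟨F, hF, hFf⟩ := hf L fun z hz => by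
    rw [SetLike.mem_coe, AffineSubspace.mem_mk', vsub_eq_sub] at hz
    obtain ⟨s, hs⟩ := Submodule.mem_span_singleton.1 hz
    have := h s
    rwa [hs, add_sub_cancel] at this
  obtain ⟨p, hp, hpF⟩ := exists_polynomial_eval_line F x y
  exact ⟨p, hp.trans hF, fun s => by rw [hFf _ (hmem s), hpF]⟩

theorem IsPolyOn.sum {ι : Type*} (T : Finset ι) (g : ι → (σ → K) → K)
    (h : ∀ i ∈ T, IsPolyOn a S (g i)) : IsPolyOn a S fun x => ∑ i ∈ T, g i x := by
  choose! F hF hFg using h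
  refine ⟨∑ i ∈ T, F i, totalDegree_finsetSum_le hF, fun x hx => ?_⟩
  rw [map_sum]
  exact Finset.sum_congr rfl fun i hi => hFg i hi x hx

theorem IsPolyOn.const_mul (r : K) (h : IsPolyOn a S f) : IsPolyOn a S fun x => r * f x := by
  obtain ⟨F, hF, hFf⟩ := h
  refine ⟨C r * F, (totalDegree_mul _ _).trans (by simpa using hF), fun x hx => ?_⟩
  simp [hFf x hx]

theorem IsWeaklyPolyOn.sum_mul {ι : Type*} (T : Finset ι) (r : ι → K) (g : ι → (σ → K) → K)
    (h : ∀ i ∈ T, IsWeaklyPolyOn a S (g i)) :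
    IsWeaklyPolyOn a S fun x => ∑ i ∈ T, r i * g i x := fun L hL =>
  IsPolyOn.sum T _ fun i hi => (h i hi L hL).const_mul (r i)

/-- Coordinatewise multiplication is linear, so it maps affine subspaces of `S` to affine subspaces
of `S`, even when some `w v` vanish. -/
theorem IsWeaklyPolyOn.comp_mul (hf : IsWeaklyPolyOn a S f) (w : σ → K)
    (hw : ∀ x ∈ S, w * x ∈ S) : IsWeaklyPolyOn a S fun x => f (w * x) := by
  intro L hL
  obtain ⟨F, hF, hFf⟩ := hf (L.map (LinearMap.mulLeft K w).toAffineMap) (by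
    rintro _ ⟨x, hx, rfl⟩
    exact hw x (hL hx))
  refine ⟨aeval (fun v => C (w v) * X v) F,
    (totalDegree_aeval_le (D := 1) _ (fun v => ?_) F).trans (by simpa using hF), fun x hx => ?_⟩
  · exact (totalDegree_mul _ _).trans (by simp)
  · refine (hFf (w * x) ⟨x, hx, rfl⟩).trans ?_
    rw [eval_aeval_eq]
    congr 2
    ext v
    simp

end WeaklyPoly

set_option linter.unusedSectionVars false

/-! ### Block varieties and the decomposition under scalings -/

section Blocks

variable {K σ ι Λ : Type*} [Field K] [Fintype σ] [DecidableEq σ] [Fintype ι] [DecidableEq ι]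
  [DecidableEq Λ]

/-- The product of the coordinates in the block `b`. -/
def blockProd (blk : σ → ι) (x : σ → K) (b : ι) : K :=
  ∏ v with blk v = b, x v

/-- The common zeros of the sums of block products over the groups of blocks. -/
def blockVariety (K : Type*) [Field K] (blk : σ → ι) (grp : ι → Λ) : Set (σ → K) :=
  {x | ∀ l, ∑ b with grp b = l, blockProd blk x b = 0}

/-- A choice of one variable from every block. -/
def IsChoice (blk : σ → ι) (j : ι → σ) : Prop := ∀ b, blk (j b) = b

/-- Scaling by `s` the variables that the choice `j` selects. -/
def scale (blk : σ → ι) (j : ι → σ) (s : K) (x : σ → K) : σ → K :=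
  (fun v => if v = j (blk v) then s else 1) * x

/-- The function `f` is homogeneous of degree `i` for the scalings of the choice `j`. -/
def IsHomogeneousFor (blk : σ → ι) (grp : ι → Λ) (j : ι → σ) (i : ℕ) (f : (σ → K) → K) : Prop :=
  ∀ x ∈ blockVariety K blk grp, ∀ s : K, f (scale blk j s x) = s ^ i * f x

variable {blk : σ → ι} {grp : ι → Λ} {j j' : ι → σ} {a : ℕ} {f : (σ → K) → K}

theorem scale_apply (s : K) (x : σ → K) (v : σ) :
    scale blk j s x v = if v = j (blk v) then s * x v else x v := by
  simp [scale]

theorem scale_one (x : σ → K) : scale blk j 1 x = x := by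
  ext v
  simp [scale_apply]

theorem scale_scale (r s : K) (x : σ → K) :
    scale blk j r (scale blk j s x) = scale blk j (r * s) x := by
  ext v
  simp only [scale_apply]
  split_ifs <;> ring

theorem scale_comm (r s : K) (x : σ → K) :
    scale blk j r (scale blk j' s x) = scale blk j' s (scale blk j r x) :=
  mul_left_comm _ _ _

theorem blockProd_eq_zero {x : σ → K} {v : σ} (h : x v = 0) : blockProd blk x (blk v) = 0 :=
  Finset.prod_eq_zero (by simp) h

theorem blockProd_scale (hj : IsChoice blk j) (s : K) (x : σ → K) (b : ι) :
    blockProd blk (scale blk j s x) b = s * blockProd blk x b := by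
  have hmem : j b ∈ Finset.univ.filter (fun v => blk v = b) := by simp [hj b]
  rw [blockProd, blockProd, ← Finset.mul_prod_erase _ _ hmem, ← Finset.mul_prod_erase _ _ hmem,
    scale_apply, if_pos (by rw [hj b]), mul_assoc]
  congr 2
  refine Finset.prod_congr rfl fun v hv => ?_
  rw [Finset.mem_erase, Finset.mem_filter] at hv
  rw [scale_apply, if_neg (by rw [hv.2.2]; exact hv.1)]

theorem scale_mem (hj : IsChoice blk j) {x : σ → K} (hx : x ∈ blockVariety K blk grp) (s : K) :
    scale blk j s x ∈ blockVariety K blk grp := fun l => by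
  simp only [blockProd_scale hj, ← Finset.mul_sum, hx l, mul_zero]

theorem IsWeaklyPolyOn.comp_scale (hf : IsWeaklyPolyOn a (blockVariety K blk grp) f)
    (hj : IsChoice blk j) (s : K) :
    IsWeaklyPolyOn a (blockVariety K blk grp) fun x => f (scale blk j s x) :=
  hf.comp_mul _ fun _ hx => scale_mem hj hx s

/-- As `s` varies, the scaled points trace a line (or a point), to which weak polynomiality applies.
-/
theorem scale_eq_add_smul (s : K) (x : σ → K) :
    scale blk j s x = (fun v => if v = j (blk v) then 0 else x v) +
      s • fun v => if v = j (blk v) then x v else 0 := by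
  ext v
  simp only [scale_apply, Pi.add_apply, Pi.smul_apply, smul_eq_mul]
  split_ifs <;> simp

theorem IsWeaklyPolyOn.exists_polynomial_scale (hf : IsWeaklyPolyOn a (blockVariety K blk grp) f)
    (hj : IsChoice blk j) {x : σ → K} (hx : x ∈ blockVariety K blk grp) :
    ∃ p : Polynomial K, p.natDegree ≤ a ∧ ∀ s : K, f (scale blk j s x) = p.eval s := by
  simp only [scale_eq_add_smul]
  exact hf.exists_polynomial_line fun s => by
    rw [← scale_eq_add_smul]
    exact scale_mem hj hx s

/-- A weakly polynomial function is a sum of functions homogeneous for the scalings of a choice. -/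
theorem IsWeaklyPolyOn.exists_sum_isHomogeneousFor (ha : (a : ℕ∞) < ENat.card K)
    (hf : IsWeaklyPolyOn a (blockVariety K blk grp) f) (hj : IsChoice blk j) :
    ∃ g : ℕ → (σ → K) → K,
      (∀ x ∈ blockVariety K blk grp, f x = ∑ i ∈ Finset.range (a + 1), g i x) ∧
      ∀ i, IsWeaklyPolyOn a (blockVariety K blk grp) (g i) ∧ IsHomogeneousFor blk grp j i (g i) ∧
        ∀ j' i', IsChoice blk j' → IsHomogeneousFor blk grp j' i' f →
          IsHomogeneousFor blk grp j' i' (g i) := by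
  classical
  obtain ⟨T, hT⟩ := exists_finset_card_eq_succ ha
  -- The `i`-th coefficient in `s` of `f (scale blk j s x)`, by interpolation at `a + 1` nodes. As a
  -- fixed linear combination of the functions `f (scale blk j r x)`, it stays weakly polynomial and
  -- keeps homogeneity for other choices.
  let g : ℕ → (σ → K) → K := fun i x =>
    ∑ r ∈ T, (Lagrange.basis T id r).coeff i * f (scale blk j r x)
  have key : ∀ x, ∀ p : Polynomial K, p.natDegree ≤ a →
      (∀ s : K, f (scale blk j s x) = p.eval s) → ∀ i, g i x = p.coeff i := by
    intro x p hp h i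
    have hp' : p = Lagrange.interpolate T id fun r => p.eval (id r) :=
      Lagrange.eq_interpolate (fun _ _ _ _ h => h) (by
        rw [hT]
        exact (Polynomial.degree_le_of_natDegree_le hp).trans_lt
          (by exact_mod_cast Nat.lt_succ_self a))
    rw [hp', Lagrange.interpolate_apply, Polynomial.finsetSum_coeff]
    refine Finset.sum_congr rfl fun r _ => ?_
    rw [Polynomial.coeff_C_mul, id, h r, mul_comm]
  refine ⟨g, fun x hx => ?_, fun i => ⟨?_, fun x hx s => ?_, fun j' i' hj' h x hx s => ?_⟩⟩
  · obtain ⟨p, hp, h⟩ := hf.exists_polynomial_scale hj hx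
    have h1 := h 1
    rw [scale_one, Polynomial.eval_eq_sum_range' (Nat.lt_succ_of_le hp)] at h1
    rw [h1]
    exact Finset.sum_congr rfl fun i _ => by rw [key x p hp h, one_pow, mul_one]
  · exact IsWeaklyPolyOn.sum_mul T _ _ fun r _ => hf.comp_scale hj r
  · obtain ⟨p, hp, h⟩ := hf.exists_polynomial_scale hj hx
    rw [key x p hp h, key _ (p.comp (Polynomial.C s * Polynomial.X)) ?_ fun r => ?_,
      Polynomial.comp_C_mul_X_coeff, mul_comm]
    · refine Polynomial.natDegree_comp_le.trans ?_
      have h1 : (Polynomial.C s * Polynomial.X).natDegree ≤ 1 := by compute_degree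
      exact (Nat.mul_le_mul_left _ h1).trans ((mul_one _).le.trans hp)
    · rw [scale_scale, h, Polynomial.eval_comp]
      simp [mul_comm r s]
  · simp only [g, Finset.mul_sum]
    refine Finset.sum_congr rfl fun r _ => ?_
    rw [scale_comm, h _ (scale_mem hj hx r)]
    ring

/-- It suffices to treat weakly polynomial functions homogeneous for all choices. -/
theorem isPolyOn_of_forall_isHomogeneousFor (ha : (a : ℕ∞) < ENat.card K)
    (H : ∀ (f : (σ → K) → K) (κ : (ι → σ) → ℕ), IsWeaklyPolyOn a (blockVariety K blk grp) f →
      (∀ j, IsChoice blk j → κ j ≤ a ∧ IsHomogeneousFor blk grp j (κ j) f) →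
      IsPolyOn a (blockVariety K blk grp) f)
    (hf : IsWeaklyPolyOn a (blockVariety K blk grp) f) :
    IsPolyOn a (blockVariety K blk grp) f := by
  classical
  -- `A` holds the choices for which homogeneity is not yet known; each induction step decomposes
  -- along one of them.
  have key : ∀ (A : Finset (ι → σ)) (f : (σ → K) → K),
      IsWeaklyPolyOn a (blockVariety K blk grp) f →
      (∀ j, IsChoice blk j → j ∉ A → ∃ i ≤ a, IsHomogeneousFor blk grp j i f) →
      IsPolyOn a (blockVariety K blk grp) f := by
    intro A
    induction A using Finset.induction_on with
    | empty =>
      intro f hf h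
      choose! κ hκ using fun j hj => h j hj (Finset.notMem_empty j)
      exact H f κ hf hκ
    | insert j₀ A hj₀ ih =>
      intro f hf h
      by_cases hch : IsChoice blk j₀
      · obtain ⟨g, hfg, hg⟩ := hf.exists_sum_isHomogeneousFor ha hch
        have hpoly : IsPolyOn a (blockVariety K blk grp)
            fun x => ∑ i ∈ Finset.range (a + 1), g i x := by
          refine IsPolyOn.sum _ _ fun i hi => ih _ (hg i).1 fun j hj hjA => ?_
          by_cases hjj : j = j₀
          · exact ⟨i, Nat.lt_succ_iff.1 (Finset.mem_range.1 hi), hjj ▸ (hg i).2.1⟩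
          · obtain ⟨i', hi', h'⟩ := h j hj (by simp [hjj, hjA])
            exact ⟨i', hi', (hg i).2.2 j i' hj h'⟩
        obtain ⟨F, hF, hFg⟩ := hpoly
        exact ⟨F, hF, fun x hx => (hfg x hx).trans (hFg x hx)⟩
      · exact ih f hf fun j hj hjA => h j hj fun hmem =>
          (Finset.mem_insert.1 hmem).elim (fun h => hch (h ▸ hj)) hjA
  exact key Finset.univ f hf fun j _ hj => absurd (Finset.mem_univ j) hj

end Blocks

/-! ### Monomial form of functions homogeneous for all choices -/

section Blocks

variable {K σ ι Λ : Type*} [Field K] [Fintype σ] [DecidableEq σ] [Fintype ι] [DecidableEq ι]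
  [DecidableEq Λ] {blk : σ → ι} {grp : ι → Λ} {j : ι → σ} {a : ℕ} {f : (σ → K) → K}

theorem mem_blockVariety_of_blockProd_eq {x y : σ → K} (hx : x ∈ blockVariety K blk grp)
    (h : ∀ b, blockProd blk y b = blockProd blk x b) : y ∈ blockVariety K blk grp := fun l => by
  simp only [h, hx l]

theorem IsChoice.update (hj : IsChoice blk j) (w : σ) :
    IsChoice blk (Function.update j (blk w) w) := fun b => by
  by_cases h : b = blk w
  · subst h
    rw [Function.update_self]
  · rw [Function.update_of_ne h, hj b]

theorem blockProd_update_of_ne {x : σ → K} {u : σ} {b : ι} (hb : b ≠ blk u) (t : K) :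
    blockProd blk (Function.update x u t) b = blockProd blk x b :=
  Finset.prod_congr rfl fun v hv => Function.update_of_ne
    (fun h => hb (by rw [← (Finset.mem_filter.1 hv).2, h])) _ _

theorem blockProd_update_of_eq_zero {x : σ → K} {u w : σ} (huw : w ≠ u) (hblk : blk u = blk w)
    (hw : x w = 0) (t : K) (b : ι) :
    blockProd blk (Function.update x u t) b = blockProd blk x b := by
  by_cases hb : b = blk u
  · rw [hb, hblk, blockProd_eq_zero hw, blockProd_eq_zero (by rw [Function.update_of_ne huw, hw])]
  · exact blockProd_update_of_ne hb t

/-- Comparison of two scalings at a point with a vanishing coordinate. -/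
theorem exists_polynomial_of_coord_eq_zero (h2a : ((2 * a : ℕ) : ℕ∞) < ENat.card K)
    (hf : IsWeaklyPolyOn a (blockVariety K blk grp) f) (hj : IsChoice blk j) {w : σ}
    (hw : w ≠ j (blk w)) {i i' : ℕ} (hi : i ≤ a) (hi' : i' ≤ a)
    (h : IsHomogeneousFor blk grp j i f)
    (h' : IsHomogeneousFor blk grp (Function.update j (blk w) w) i' f) {x : σ → K}
    (hx : x ∈ blockVariety K blk grp) (hxw : x w = 0) :
    ∃ p : Polynomial K,
      (∀ s, f (Function.update x (j (blk w)) (s * x (j (blk w)))) = p.eval s) ∧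
      Polynomial.X ^ i' * p = Polynomial.C (f x) * Polynomial.X ^ i := by
  set u := j (blk w) with hu
  -- The block product is zero because `x w = 0`, so the coordinate `u` of the same block is free.
  have hmem : ∀ t, Function.update x u t ∈ blockVariety K blk grp := fun t =>
    mem_blockVariety_of_blockProd_eq hx (blockProd_update_of_eq_zero hw (hj _) hxw t)
  have hline : ∀ s : K, Function.update x u 0 + s • Pi.single u (x u) =
      Function.update x u (s * x u) := fun s => by
    ext v
    by_cases hv : v = u
    · subst hv
      simp
    · simp [hv]
  obtain ⟨p, hp, hfp⟩ := hf.exists_polynomial_line (x := Function.update x u 0)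
    (y := Pi.single u (x u)) fun s => by rw [hline]; exact hmem _
  simp only [hline] at hfp
  -- Both sides have degree at most `2 * a`; this is where `2 * a < |K|` enters.
  refine ⟨p, hfp, polynomial_eq_of_eval_eq h2a ?_ ?_ fun s => ?_⟩
  · refine Polynomial.natDegree_mul_le.trans ?_
    rw [Polynomial.natDegree_X_pow]
    omega
  · exact (Polynomial.natDegree_C_mul_X_pow_le _ _).trans (by omega)
  -- Scaling the zero coordinate `w` does nothing, so scaling `u` by hand and then along the updated
  -- choice amounts to scaling `x` along `j`.
  · have hs : scale blk (Function.update j (blk w) w) s (Function.update x u (s * x u)) =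
        scale blk j s x := by
      ext v
      rw [scale_apply, scale_apply]
      by_cases hb : blk v = blk w
      · rw [hb, Function.update_self, ← hu]
        by_cases hvw : v = w
        · subst hvw
          simp [hw, hxw]
        · by_cases hvu : v = u
          · rw [if_neg hvw, if_pos hvu, hvu, Function.update_self]
          · rw [if_neg hvw, if_neg hvu, Function.update_of_ne hvu]
      · have hvu : v ≠ u := fun h => hb (by rw [h, hu, hj])
        rw [Function.update_of_ne hb, Function.update_of_ne hvu]
    have := h' _ (hmem (s * x u)) s
    rw [hs, h x hx, hfp] at this
    rw [Polynomial.eval_mul, Polynomial.eval_pow, Polynomial.eval_X, ← this, Polynomial.eval_mul,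
      Polynomial.eval_C, Polynomial.eval_pow, Polynomial.eval_X, mul_comm]

/-- In `X ^ i' * p = C (f x) * X ^ i` the left side has no term of degree `i < i'`. -/
theorem eq_zero_of_coord_eq_zero (h2a : ((2 * a : ℕ) : ℕ∞) < ENat.card K)
    (hf : IsWeaklyPolyOn a (blockVariety K blk grp) f) (hj : IsChoice blk j) {w : σ}
    (hw : w ≠ j (blk w)) {i i' : ℕ} (hi' : i' ≤ a) (hii' : i < i')
    (h : IsHomogeneousFor blk grp j i f)
    (h' : IsHomogeneousFor blk grp (Function.update j (blk w) w) i' f) {x : σ → K}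
    (hx : x ∈ blockVariety K blk grp) (hxw : x w = 0) : f x = 0 := by
  obtain ⟨p, -, hp⟩ := exists_polynomial_of_coord_eq_zero h2a hf hj hw (hii'.le.trans hi') hi' h h'
    hx hxw
  have := congrArg (fun q => Polynomial.coeff q i) hp
  simpa [Polynomial.coeff_X_pow_mul', Nat.not_le.2 hii'] using this.symm

/-- With equal exponents the power of `X` cancels and `p` is the constant `f x`; evaluate it at `0`.
-/
theorem eq_update_zero_of_coord_eq_zero (h2a : ((2 * a : ℕ) : ℕ∞) < ENat.card K)
    (hf : IsWeaklyPolyOn a (blockVariety K blk grp) f) (hj : IsChoice blk j) {w : σ}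
    (hw : w ≠ j (blk w)) {i : ℕ} (hi : i ≤ a) (h : IsHomogeneousFor blk grp j i f)
    (h' : IsHomogeneousFor blk grp (Function.update j (blk w) w) i f) {x : σ → K}
    (hx : x ∈ blockVariety K blk grp) (hxw : x w = 0) :
    f x = f (Function.update x (j (blk w)) 0) := by
  obtain ⟨p, hfp, hp⟩ := exists_polynomial_of_coord_eq_zero h2a hf hj hw hi hi h h' hx hxw
  rw [mul_comm] at hp
  have hp' := mul_right_cancel₀ (pow_ne_zero i Polynomial.X_ne_zero) hp
  have := hfp 0
  rw [zero_mul, hp', Polynomial.eval_C] at this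
  exact this.symm

/-- Moving the value of the coordinate `v` to the chosen coordinate of its block. -/
def shift (blk : σ → ι) (j : ι → σ) (v : σ) (x : σ → K) : σ → K :=
  Function.update (Function.update x v 1) (j (blk v)) (x (j (blk v)) * x v)

theorem blockProd_shift (hj : IsChoice blk j) {v : σ} (hv : v ≠ j (blk v)) (x : σ → K) (b : ι) :
    blockProd blk (shift blk j v x) b = blockProd blk x b := by
  by_cases hb : b = blk v
  · subst hb
    have hu : j (blk v) ∈ Finset.univ.filter (fun w => blk w = blk v) := by simp [hj (blk v)]
    have hv' : v ∈ (Finset.univ.filter (fun w => blk w = blk v)).erase (j (blk v)) := by simp [hv]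
    rw [blockProd, blockProd, ← Finset.mul_prod_erase _ _ hu, ← Finset.mul_prod_erase _ _ hu,
      ← Finset.mul_prod_erase _ _ hv', ← Finset.mul_prod_erase _ _ hv', shift, Function.update_self,
      Function.update_of_ne hv, Function.update_self, one_mul, mul_assoc]
    congr 2
    refine Finset.prod_congr rfl fun w hw => ?_
    rw [Finset.mem_erase, Finset.mem_erase] at hw
    rw [Function.update_of_ne hw.2.1, Function.update_of_ne hw.1]
  · rw [shift, blockProd_update_of_ne (by rwa [hj]), blockProd_update_of_ne hb]

/-- If `x v ≠ 0`, scaling `x` along `j` and its shift along the updated choice, both by `x v`, gives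
the same point, and `x v ^ i` cancels. If `x v = 0` and `e > 0`, both sides vanish; if `e = 0`, both
values equal that at the point where `v` and `j (blk v)` are set to zero. -/
theorem eq_pow_mul_shift (h2a : ((2 * a : ℕ) : ℕ∞) < ENat.card K)
    (hf : IsWeaklyPolyOn a (blockVariety K blk grp) f) (hj : IsChoice blk j) {v : σ}
    (hv : v ≠ j (blk v)) {i e : ℕ} (hie : i + e ≤ a)
    (h : IsHomogeneousFor blk grp j i f)
    (h' : IsHomogeneousFor blk grp (Function.update j (blk v) v) (i + e) f) {x : σ → K}
    (hx : x ∈ blockVariety K blk grp) : f x = x v ^ e * f (shift blk j v x) := by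
  have hx' : shift blk j v x ∈ blockVariety K blk grp :=
    mem_blockVariety_of_blockProd_eq hx (blockProd_shift hj hv x)
  by_cases hxv : x v = 0
  · rcases Nat.eq_zero_or_pos e with rfl | he
    · rw [pow_zero, one_mul, eq_update_zero_of_coord_eq_zero h2a hf hj hv (by omega) h h' hx hxv]
      have hj' := hj.update v
      have hblk : blk (j (blk v)) = blk v := hj _
      have hback : Function.update (Function.update j (blk v) v) (blk (j (blk v))) (j (blk v)) =
          j := by
        rw [hblk, Function.update_idem, Function.update_eq_self]
      have := eq_update_zero_of_coord_eq_zero h2a hf hj' (w := j (blk v))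
        (by rw [hblk, Function.update_self]; exact hv.symm) hie h' (by rw [hback]; exact h) hx'
        (by rw [shift, Function.update_self, hxv, mul_zero])
      rw [this]
      congr 1
      rw [hblk, Function.update_self]
      ext w
      by_cases hwv : w = v
      · rw [hwv, Function.update_self, Function.update_of_ne hv, hxv]
      · rw [Function.update_of_ne hwv, shift]
        by_cases hwu : w = j (blk v)
        · rw [hwu, Function.update_self, Function.update_self, hxv, mul_zero]
        · rw [Function.update_of_ne hwu, Function.update_of_ne hwu, Function.update_of_ne hwv]
    · rw [hxv, zero_pow he.ne', zero_mul]
      exact eq_zero_of_coord_eq_zero h2a hf hj hv hie (by omega) h h' hx hxv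
  · have hs : scale blk (Function.update j (blk v) v) (x v) (shift blk j v x) =
        scale blk j (x v) x := by
      ext w
      rw [scale_apply, scale_apply, shift]
      by_cases hb : blk w = blk v
      · rw [hb, Function.update_self]
        by_cases hwv : w = v
        · rw [if_pos hwv, hwv, if_neg hv, Function.update_of_ne hv, Function.update_self, mul_one]
        · rw [if_neg hwv]
          by_cases hwu : w = j (blk v)
          · rw [if_pos hwu, hwu, Function.update_self, mul_comm]
          · rw [if_neg hwu, Function.update_of_ne hwu, Function.update_of_ne hwv]
      · have hwu : w ≠ j (blk v) := fun h => hb (by rw [h, hj])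
        have hwv : w ≠ v := fun h => hb (by rw [h])
        rw [Function.update_of_ne hb, Function.update_of_ne hwu, Function.update_of_ne hwv]
    have h1 := h' _ hx' (x v)
    rw [hs, h x hx, pow_add, mul_assoc] at h1
    exact mul_left_cancel₀ (pow_ne_zero i hxv) h1

/-- The point with the same block products as `x` whose coordinates outside the choice `j` are
equal to one. -/
def normalize (blk : σ → ι) (j : ι → σ) (x : σ → K) (v : σ) : K :=
  if v = j (blk v) then blockProd blk x (blk v) else 1

theorem normalize_congr {x y : σ → K} (h : ∀ b, blockProd blk y b = blockProd blk x b) :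
    normalize blk j y = normalize blk j x := by
  ext v
  simp only [normalize, h]

theorem normalize_eq_self {x : σ → K}
    (hx : ∀ v, v ≠ j (blk v) → x v = 1) : normalize blk j x = x := by
  ext v
  by_cases hv : v = j (blk v)
  · rw [normalize, if_pos hv, blockProd, Finset.prod_eq_single_of_mem v (by simp)]
    intro w hw hwv
    rw [Finset.mem_filter] at hw
    exact hx w fun h => hwv (by rw [h, hw.2, ← hv])
  · rw [normalize, if_neg hv, hx v hv]

/-- The monomial form of a function which is homogeneous for all choices. -/
theorem eq_prod_mul_normalize (h2a : ((2 * a : ℕ) : ℕ∞) < ENat.card K)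
    (hf : IsWeaklyPolyOn a (blockVariety K blk grp) f) (hj : IsChoice blk j) {k : ℕ} {e : σ → ℕ}
    (h : IsHomogeneousFor blk grp j k f) (hea : ∀ v, k + e v ≤ a) (he0 : ∀ b, e (j b) = 0)
    (h' : ∀ v, IsHomogeneousFor blk grp (Function.update j (blk v) v) (k + e v) f) {x : σ → K}
    (hx : x ∈ blockVariety K blk grp) : f x = (∏ v, x v ^ e v) * f (normalize blk j x) := by
  -- `A` contains the unchosen coordinates that may differ from one; each shift removes one of them
  -- and contributes its power.
  have key : ∀ (A : Finset σ) (x : σ → K), x ∈ blockVariety K blk grp →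
      (∀ v ∉ A, v ≠ j (blk v) → x v = 1) → f x = (∏ v, x v ^ e v) * f (normalize blk j x) := by
    intro A
    induction A using Finset.induction_on with
    | empty =>
      intro x hx h1
      replace h1 : ∀ v, v ≠ j (blk v) → x v = 1 := fun v => h1 v (Finset.notMem_empty v)
      rw [normalize_eq_self h1, Finset.prod_eq_one, one_mul]
      intro v _
      by_cases hv : v = j (blk v)
      · rw [hv, he0, pow_zero]
      · rw [h1 v hv, one_pow]
    | insert v A hvA ih =>
      intro x hx h1
      by_cases hv : v = j (blk v)
      · refine ih x hx fun w hw hwj => h1 w (fun hmem => ?_) hwj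
        rcases Finset.mem_insert.1 hmem with rfl | hmem
        · exact hwj hv
        · exact hw hmem
      · have hprod := blockProd_shift hj hv x
        rw [eq_pow_mul_shift h2a hf hj hv (hea v) h (h' v) hx,
          ih _ (mem_blockVariety_of_blockProd_eq hx hprod) ?_, normalize_congr hprod, ← mul_assoc]
        · congr 1
          rw [← Finset.mul_prod_erase _ _ (Finset.mem_univ v),
            ← Finset.mul_prod_erase _ (fun w => x w ^ e w) (Finset.mem_univ v)]
          congr 1
          rw [shift, Function.update_of_ne hv, Function.update_self, one_pow, one_mul]
          refine Finset.prod_congr rfl fun w hw => ?_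
          by_cases hwu : w = j (blk v)
          · rw [hwu, he0, pow_zero, pow_zero]
          · rw [Function.update_of_ne hwu, Function.update_of_ne (Finset.mem_erase.1 hw).1]
        · intro w hw hwj
          have hwu : w ≠ j (blk v) := fun h => hwj (by rw [h, hj])
          rw [shift, Function.update_of_ne hwu]
          by_cases hwv : w = v
          · rw [hwv, Function.update_self]
          · rw [Function.update_of_ne hwv]
            exact h1 w (by simp [hwv, hw]) hwj
  exact key Finset.univ x hx fun v hv => absurd (Finset.mem_univ v) hv

end Blocks

/-! ### Polynomiality at normalized points, and degree bounds -/

section Blocks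

variable {K σ ι Λ : Type*} [Field K] [Fintype σ] [DecidableEq σ] [Fintype ι] [DecidableEq ι]
  [DecidableEq Λ] {blk : σ → ι} {grp : ι → Λ} {j : ι → σ} {a : ℕ} {f : (σ → K) → K}

theorem normalize_scale (hj : IsChoice blk j) (s : K) (x : σ → K) :
    normalize blk j (scale blk j s x) = scale blk j s (normalize blk j x) := by
  ext v
  rw [scale_apply, normalize, normalize, blockProd_scale hj]
  split_ifs <;> rfl

/-- The affine space of the points whose coordinates outside the choice `j` are one and which lie
in the block variety. -/
def choiceSubspace (K : Type*) [Field K] (blk : σ → ι) (grp : ι → Λ) (j : ι → σ) :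
    AffineSubspace K (σ → K) where
  carrier := {x | (∀ v, v ≠ j (blk v) → x v = 1) ∧ ∀ l, ∑ b with grp b = l, x (j b) = 0}
  smul_vsub_vadd_mem' := by
    rintro s x y z ⟨hx, hx'⟩ ⟨hy, hy'⟩ ⟨hz, hz'⟩
    refine ⟨fun v hv => ?_, fun l => ?_⟩
    · simp [hx v hv, hy v hv, hz v hv]
    · simp [Finset.sum_add_distrib, ← Finset.mul_sum, hx' l, hy' l, hz' l]

/-- When the unchosen coordinates are one, each block product is the chosen coordinate, so the
equations become linear. -/
theorem choiceSubspace_subset (hj : IsChoice blk j) :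
    (choiceSubspace K blk grp j : Set (σ → K)) ⊆ blockVariety K blk grp := by
  rintro x ⟨hx, hx'⟩ l
  rw [← hx' l]
  refine Finset.sum_congr rfl fun b _ => ?_
  have := congrFun (normalize_eq_self hx) (j b)
  rw [normalize, hj, if_pos rfl] at this
  exact this

theorem normalize_mem_choiceSubspace (hj : IsChoice blk j) {x : σ → K}
    (hx : x ∈ blockVariety K blk grp) : normalize blk j x ∈ choiceSubspace K blk grp j := by
  refine ⟨fun v hv => if_neg hv, fun l => ?_⟩
  rw [← hx l]
  refine Finset.sum_congr rfl fun b _ => ?_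
  rw [normalize, hj, if_pos rfl]

/-- At normalized points a homogeneous function is a form in the block products. -/
theorem exists_isHomogeneous_eval_blockProd (ha : (a : ℕ∞) < ENat.card K)
    (hf : IsWeaklyPolyOn a (blockVariety K blk grp) f) (hj : IsChoice blk j) {k : ℕ} (hk : k ≤ a)
    (h : IsHomogeneousFor blk grp j k f) :
    ∃ G : MvPolynomial ι K, G.totalDegree ≤ k ∧
      ∀ x ∈ blockVariety K blk grp, f (normalize blk j x) = eval (blockProd blk x) G := by
  obtain ⟨F, hF, hFf⟩ := hf _ (choiceSubspace_subset (grp := grp) hj)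
  let G : MvPolynomial ι K := aeval (fun v => if v = j (blk v) then X (blk v) else 1) F
  have hG : G.totalDegree ≤ a := by
    refine (totalDegree_aeval_le (D := 1) _ (fun v => ?_) F).trans (by simpa using hF)
    split_ifs <;> simp
  have hfG : ∀ x ∈ blockVariety K blk grp, f (normalize blk j x) = eval (blockProd blk x) G := by
    intro x hx
    rw [hFf _ (normalize_mem_choiceSubspace hj hx), eval_aeval_eq]
    congr 2
    ext v
    rw [normalize]
    split_ifs <;> simp
  -- Homogeneity of `f` makes the values along each line `s ^ k` times a constant, so only the
  -- component of degree `k` matters. The bound `k`, rather than `a`, is needed for the final degree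
  -- count.
  refine ⟨homogeneousComponent k G, (homogeneousComponent_isHomogeneous k G).totalDegree_le,
    fun x hx => ?_⟩
  rw [eval_homogeneousComponent_eq_coeff ha hG
    (p := Polynomial.C (f (normalize blk j x)) * Polynomial.X ^ k)
    ((Polynomial.natDegree_C_mul_X_pow_le _ _).trans hk) fun s => ?_, Polynomial.coeff_C_mul_X_pow,
    if_pos rfl]
  have hs : blockProd blk (scale blk j s x) = s • blockProd blk x := by
    ext b
    exact blockProd_scale hj s x b
  rw [← hs, ← hfG _ (scale_mem hj hx s), normalize_scale hj, h _ (choiceSubspace_subset hj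
    (normalize_mem_choiceSubspace hj hx)), Polynomial.eval_mul, Polynomial.eval_C,
    Polynomial.eval_pow, Polynomial.eval_X, mul_comm]

/-- The degrees of homogeneity depend additively on the choice. -/
theorem degree_add_sum_eq (h2a : ((2 * a : ℕ) : ℕ∞) < ENat.card K) {κ : (ι → σ) → ℕ}
    (hκ : ∀ j, IsChoice blk j → κ j ≤ a ∧ IsHomogeneousFor blk grp j (κ j) f) {x : σ → K}
    (hx : x ∈ blockVariety K blk grp) (hfx : f x ≠ 0) {j₀ : ι → σ} (hj₀ : IsChoice blk j₀)
    {e : σ → ℕ} (he : ∀ v, κ (Function.update j₀ (blk v) v) = κ j₀ + e v)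
    (hj : IsChoice blk j) : κ j = κ j₀ + ∑ b, e (j b) := by
  have key : ∀ A : Finset ι, κ (fun b => if b ∈ A then j b else j₀ b) =
      κ j₀ + ∑ b ∈ A, e (j b) := by
    intro A
    induction A using Finset.induction_on with
    | empty => simp
    | insert c A hc ih =>
      have hjA : ∀ A : Finset ι, IsChoice blk fun b => if b ∈ A then j b else j₀ b := fun A b => by
        dsimp only
        split_ifs
        · exact hj b
        · exact hj₀ b
      set j₁ : ι → σ := fun b => if b ∈ A then j b else j₀ b with hj₁
      set j₂ : ι → σ := fun b => if b ∈ insert c A then j b else j₀ b with hj₂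
      have hup := he (j c)
      have hup' := hκ _ (hj₀.update (j c))
      rw [hj c] at hup hup'
      -- In block `c` the two selected variables are swapped between the scalings, elsewhere they
      -- agree. Since `f x ≠ 0`, comparing powers of `s`, of exponent at most `2 * a`, yields an
      -- additive relation between degrees.
      have hcomm : ∀ s : K, scale blk j₂ s (scale blk j₀ s x) =
          scale blk j₁ s (scale blk (Function.update j₀ c (j c)) s x) := fun s => by
        ext v
        simp only [scale_apply, hj₁, hj₂, Finset.mem_insert]
        by_cases hv : blk v = c
        · simp only [hv, true_or, if_true, hc, if_false, Function.update_self]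
          split_ifs <;> rfl
        · simp [hv]
      have hpow : (Polynomial.C (f x) * Polynomial.X ^ (κ j₂ + κ j₀) : Polynomial K) =
          Polynomial.C (f x) * Polynomial.X ^ (κ j₁ + κ (Function.update j₀ c (j c))) := by
        have h0 := (hκ j₀ hj₀).1
        have h1 := (hκ j₁ (hjA A)).1
        have h2 := (hκ j₂ (hjA _)).1
        have h3 := hup'.1
        refine polynomial_eq_of_eval_eq h2a
          ((Polynomial.natDegree_C_mul_X_pow_le _ _).trans (by omega))
          ((Polynomial.natDegree_C_mul_X_pow_le _ _).trans (by omega)) fun s => ?_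
        have := congrArg f (hcomm s)
        rw [(hκ j₂ (hjA _)).2 _ (scale_mem hj₀ hx s), (hκ j₀ hj₀).2 x hx,
          (hκ j₁ (hjA A)).2 _ (scale_mem (by simpa [hj c] using hj₀.update (j c)) hx s),
          hup'.2 x hx] at this
        simp only [Polynomial.eval_mul, Polynomial.eval_C, Polynomial.eval_pow, Polynomial.eval_X,
          pow_add]
        linear_combination this
      have hdeg := congrArg Polynomial.natDegree hpow
      rw [Polynomial.natDegree_C_mul_X_pow _ _ hfx, Polynomial.natDegree_C_mul_X_pow _ _ hfx]
        at hdeg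
      rw [Finset.sum_insert hc]
      omega
  simpa using key Finset.univ

/-- Apply the bound to the choice maximizing `e` in every block; a block has at most `d` variables.
-/
theorem sum_le_mul_of_forall_choice {d m : ℕ} (hd : ∀ b, (Finset.univ.filter (blk · = b)).card ≤ d)
    (hblk : Function.Surjective blk) (e : σ → ℕ)
    (he : ∀ j, IsChoice blk j → ∑ b, e (j b) ≤ m) : ∑ v, e v ≤ d * m := by
  have hmax : ∀ b, ∃ v, blk v = b ∧ ∀ w, blk w = b → e w ≤ e v := fun b => by
    obtain ⟨v, hv, hmax⟩ := Finset.exists_max_image (Finset.univ.filter (blk · = b)) e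
      (by obtain ⟨v, hv⟩ := hblk b; exact ⟨v, by simp [hv]⟩)
    exact ⟨v, (Finset.mem_filter.1 hv).2, fun w hw => hmax w (by simp [hw])⟩
  choose j hj hjmax using hmax
  calc ∑ v, e v = ∑ b, ∑ v with blk v = b, e v := (Finset.sum_fiberwise _ _ _).symm
    _ ≤ ∑ b, d * e (j b) := Finset.sum_le_sum fun b _ => by
        refine (Finset.sum_le_card_nsmul _ _ (e (j b)) fun v hv =>
          hjmax b v (Finset.mem_filter.1 hv).2).trans ?_
        exact Nat.mul_le_mul_right _ (hd b)
    _ = d * ∑ b, e (j b) := by rw [Finset.mul_sum]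
    _ ≤ d * m := Nat.mul_le_mul_left _ (he j hj)

theorem isPolyOn_of_isHomogeneousFor (h2a : ((2 * a : ℕ) : ℕ∞) < ENat.card K) {d : ℕ}
    (hd1 : 1 ≤ d) (hda : ((a * d : ℕ) : ℕ∞) < ENat.card K)
    (hd : ∀ b, (Finset.univ.filter (blk · = b)).card ≤ d) (hblk : Function.Surjective blk)
    (hcone : ∀ x ∈ blockVariety K blk grp, ∀ s : K, s • x ∈ blockVariety K blk grp)
    {κ : (ι → σ) → ℕ} (hf : IsWeaklyPolyOn a (blockVariety K blk grp) f)
    (hκ : ∀ j, IsChoice blk j → κ j ≤ a ∧ IsHomogeneousFor blk grp j (κ j) f) :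
    IsPolyOn a (blockVariety K blk grp) f := by
  classical
  by_cases hzero : ∀ x ∈ blockVariety K blk grp, f x = 0
  · exact ⟨0, by simp, fun x hx => by rw [hzero x hx, map_zero]⟩
  push Not at hzero
  obtain ⟨x₀, hx₀, hfx₀⟩ := hzero
  -- Minimality of `κ j₀` makes the subtraction defining `e` exact, so the exponents are natural
  -- numbers.
  obtain ⟨j₀, hj₀, hmin⟩ := Finset.exists_min_image (Finset.univ.filter (IsChoice blk)) κ
    ⟨Function.surjInv hblk, by simpa [IsChoice] using Function.surjInv_eq hblk⟩
  simp only [Finset.mem_filter, Finset.mem_univ, true_and] at hj₀ hmin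
  let e : σ → ℕ := fun v => κ (Function.update j₀ (blk v) v) - κ j₀
  have he : ∀ v, κ (Function.update j₀ (blk v) v) = κ j₀ + e v := fun v =>
    (Nat.add_sub_cancel' (hmin _ (hj₀.update v))).symm
  have he0 : ∀ b, e (j₀ b) = 0 := fun b => by
    simp only [e, hj₀ b, Function.update_eq_self, Nat.sub_self]
  obtain ⟨G, hG, hfG⟩ := exists_isHomogeneous_eval_blockProd
    (lt_of_le_of_lt (by exact_mod_cast (by omega : a ≤ 2 * a)) h2a) hf hj₀ (hκ j₀ hj₀).1
    (hκ j₀ hj₀).2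
  let F : MvPolynomial σ K := (∏ v, X v ^ e v) * aeval (fun b => ∏ v with blk v = b, X v) G
  have hfF : ∀ x ∈ blockVariety K blk grp, f x = eval x F := by
    intro x hx
    rw [eq_prod_mul_normalize h2a hf hj₀ (hκ j₀ hj₀).2
      (fun v => by rw [← he]; exact (hκ _ (hj₀.update v)).1) he0
      (fun v => by rw [← he]; exact (hκ _ (hj₀.update v)).2) hx, hfG x hx, map_mul, eval_aeval_eq]
    congr 1
    · simp [map_prod]
    · congr 2
      ext b
      simp [map_prod, blockProd]
  have hsum : ∑ v, e v ≤ d * (a - κ j₀) := by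
    refine sum_le_mul_of_forall_choice hd hblk e fun j hj => ?_
    have h1 := degree_add_sum_eq h2a hκ hx₀ hfx₀ hj₀ he hj
    have h2 := (hκ j hj).1
    omega
  have hF : F.totalDegree ≤ a * d := by
    refine (totalDegree_mul _ _).trans ?_
    have h1 : (∏ v, X v ^ e v : MvPolynomial σ K).totalDegree ≤ ∑ v, e v :=
      (totalDegree_finsetProd _ _).trans (Finset.sum_le_sum fun v _ => by simp)
    have h2 := totalDegree_aeval_le (D := d) (fun b => ∏ v with blk v = b, (X v : MvPolynomial σ K))
      (fun b => (totalDegree_finsetProd _ _).trans (by simpa using hd b)) G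
    have h3 : d * G.totalDegree ≤ d * κ j₀ := Nat.mul_le_mul_left _ hG
    -- The monomial costs `d * (a - κ j₀)` and the form in block products `d * κ j₀`: together
    -- exactly `a * d`.
    have h4 : d * (a - κ j₀) + d * κ j₀ = a * d := by
      rw [← mul_add, Nat.sub_add_cancel (hκ j₀ hj₀).1, mul_comm]
    omega
  -- Lines through the origin in the cone are affine subspaces of it, so `F` has degree at most `a`
  -- along each and can be truncated.
  obtain ⟨F', hF', hFF'⟩ := exists_totalDegree_le_eval_eq hda (Nat.le_mul_of_pos_right a hd1) hF
    (S := blockVariety K blk grp) fun x hx => by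
      obtain ⟨p, hp, hfp⟩ := hf.exists_polynomial_line (x := 0) (y := x) fun s => by
        rw [zero_add]
        exact hcone x hx s
      refine ⟨p, hp, fun s => ?_⟩
      rw [← hfF _ (hcone x hx s), ← hfp, zero_add]
  exact ⟨F', hF', fun x hx => (hfF x hx).trans (hFF' x hx)⟩

theorem starOver_blockVariety (h2a : ((2 * a : ℕ) : ℕ∞) < ENat.card K) {d : ℕ}
    (hd1 : 1 ≤ d) (hda : ((a * d : ℕ) : ℕ∞) < ENat.card K)
    (hd : ∀ b, (Finset.univ.filter (blk · = b)).card ≤ d) (hblk : Function.Surjective blk)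
    (hcone : ∀ x ∈ blockVariety K blk grp, ∀ s : K, s • x ∈ blockVariety K blk grp) :
    StarOver a (blockVariety K blk grp) := fun _ hf =>
  isPolyOn_of_forall_isHomogeneousFor
    (lt_of_le_of_lt (by exact_mod_cast (by omega : a ≤ 2 * a)) h2a)
    (fun _ _ hf hκ => isPolyOn_of_isHomogeneousFor h2a hd1 hda hd hblk hcone hf hκ) hf

end Blocks

/-! ### The product collection as a block variety -/

section Points

variable {k : Type u} [Field k] {n c : ℕ} {dbar : Fin c → ℕ}

/-- Blocks are the pairs `(l, i)`, one for each monomial, and the group of a block is its factor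
`l`. -/
theorem points_productCollection (K : Type*) [Field K] [Algebra k K] :
    points (productCollection k n dbar) K =
      blockVariety K (fun v : Σ l : Fin c, Fin n × Fin (dbar l) => (v.1, v.2.1)) Prod.fst := by
  ext x
  refine forall_congr' fun l => ?_
  rw [productCollection_eq, map_sum]
  have : ∑ b : Fin c × Fin n with b.1 = l, blockProd
      (fun v : Σ l : Fin c, Fin n × Fin (dbar l) => (v.1, v.2.1)) x b =
      ∑ i : Fin n, aeval x (∏ j : Fin (dbar l), (X ⟨l, (i, j)⟩ : MvPolynomial _ k)) := by
    symm
    refine Finset.sum_bij' (fun i _ => (l, i)) (fun b _ => b.2) ?_ ?_ ?_ ?_ ?_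
    · simp
    · simp
    · simp
    · rintro ⟨l', i⟩ h
      simpa using (Finset.mem_filter.1 h).2.symm
    · intro i _
      simp only [map_prod, aeval_X, blockProd]
      refine Finset.prod_bij (fun j _ => ⟨l, (i, j)⟩) ?_ ?_ ?_ ?_
      · simp
      · intro j _ j' _ h
        simpa using h
      · rintro ⟨l', i', j⟩ h
        simp only [Finset.mem_filter, Finset.mem_univ, true_and, Prod.mk.injEq] at h
        obtain ⟨rfl, rfl⟩ := h
        exact ⟨j, Finset.mem_univ j, rfl⟩
      · simp
  rw [this]

theorem card_block_le (b : Fin c × Fin n) :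
    (Finset.univ.filter fun v : Σ l : Fin c, Fin n × Fin (dbar l) => (v.1, v.2.1) = b).card ≤
      dbar b.1 := by
  have : (Finset.univ.filter fun v : Σ l : Fin c, Fin n × Fin (dbar l) => (v.1, v.2.1) = b) ⊆
      Finset.univ.image fun j : Fin (dbar b.1) => ⟨b.1, (b.2, j)⟩ := by
    rintro ⟨l, i, j⟩ h
    obtain rfl := (Finset.mem_filter.1 h).2
    simp
  exact (Finset.card_le_card this).trans (Finset.card_image_le.trans (by simp))

theorem smul_mem_points {K : Type*} [Field K] [Algebra k K]
    {x : (Σ l : Fin c, Fin n × Fin (dbar l)) → K}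
    (hx : x ∈ points (productCollection k n dbar) K) (s : K) :
    s • x ∈ points (productCollection k n dbar) K := fun l => by
  have h := hx l
  rw [productCollection_eq] at h ⊢
  simp only [map_sum, map_prod, aeval_X, Pi.smul_apply, smul_eq_mul, Finset.prod_mul_distrib,
    ← Finset.mul_sum] at h ⊢
  simp only [Finset.prod_const, h, mul_zero]

/-- The powers `β ^ i` with `i < m` are distinct. -/
theorem two_mul_lt_card_of_isPrimitiveRoot {K : Type*} [Field K] {a m : ℕ} (hm : 2 * a < m)
    {β : K} (hβ : IsPrimitiveRoot β m) : ((2 * a : ℕ) : ℕ∞) < ENat.card K := by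
  have hinj : Function.Injective fun i : Fin m => β ^ (i : ℕ) := fun i i' h =>
    Fin.ext (hβ.pow_inj i.2 i'.2 h)
  have := ENat.card_le_card_of_injective hinj
  rw [ENat.card_eq_coe_fintype_card, Fintype.card_fin] at this
  exact lt_of_lt_of_le (by exact_mod_cast hm) this

theorem hasStar_productCollection (hdbar : ∀ l, 1 ≤ dbar l) {d : ℕ} (hd1 : 1 ≤ d)
    (hd : ∀ l, dbar l ≤ d) {a : ℕ} (hk : Admissible k a d) :
    HasStar a (productCollection k n dbar) := by
  intro K _ _ _
  obtain ⟨m, β, hm, hβ⟩ := hk.exists_root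
  have hcard : ENat.card k ≤ ENat.card K :=
    ENat.card_le_card_of_injective (algebraMap k K).injective
  have h := fun x (hx : x ∈ points (productCollection k n dbar) K) (s : K) => smul_mem_points hx s
  rw [points_productCollection] at h ⊢
  refine starOver_blockVariety ((two_mul_lt_card_of_isPrimitiveRoot hm hβ).trans_le hcard) hd1
    (hk.card_gt.trans_le hcard) (fun b => (card_block_le b).trans (hd b.1)) ?_ h
  rintro ⟨l, i⟩
  exact ⟨⟨l, (i, ⟨0, hdbar l⟩)⟩, rfl⟩

end Points
end WeakPoly

end

theorem mainTheorem9 {k : Type u} [Field k] (n c : ℕ) (dbar : Fin c → ℕ)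
    (hdbar : ∀ l, 1 ≤ dbar l) (d : ℕ) (hd : IsGreatest (Set.range dbar) d) :
    (n : ℝ≥0∞) / (d : ℝ≥0∞) ≤
        ((WeakPoly.collectionRank (WeakPoly.productCollection k n dbar) : ℕ∞) : ℝ≥0∞) ∧
      ∀ a : ℕ, 1 ≤ a → WeakPoly.Admissible k a d →
        WeakPoly.HasStar a (WeakPoly.productCollection k n dbar) := by
  have hle : ∀ l, dbar l ≤ d := fun l => hd.2 ⟨l, rfl⟩
  have hd1 : 1 ≤ d := by
    obtain ⟨l, rfl⟩ := hd.1
    exact hdbar l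
  exact ⟨WeakPoly.div_le_collectionRank hdbar hd1 hle,
    fun a _ hk => WeakPoly.hasStar_productCollection hdbar hd1 hle hk⟩
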